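/- Let $\mathcal M$ be a type $\mathrm{II}_1$ factor, that is, a nonzero von Neumann algebra with centre $\mathbb C 1$ that is finite (every isometry in $\mathcal M$ is unitary) and has no minimal projection, and let $\tau$ be its faithful normal unital trace. For a self-adjoint $R\in\mathcal M$ let $m_R$ be its spectral distribution, the unique Borel probability measure on $\mathbb R$ with $\int_{\mathbb R} x^n\,dm_R(x)=\tau(R^n)$ for all $n\ge 0$. For an arbitrary $R\in\mathcal M$ and $s\in[0,1)$, let $|R|=(R^*R)^{1/2}$ and let \[ \mu_s(R)=\inf\{t\in\mathbb R : m_{|R|}((t,\infty))\le s\} \] be the singular value function of $R$. Let $S,T\in\mathcal M$. If $T$ is positive, $\mu_s(S)=\mu_s(T)$ for every $s\in[0,1)$, and $\tau(S)=\tau(T)$, then $S$ is positive. -/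

import Mathlib

open scoped ComplexOrder CompactlySupported

section IIOneFactor

universe u

variable {H : Type u} [NormedAddCommGroup H] [InnerProductSpace ℂ H] [CompleteSpace H]

/-- A von Neumann algebra `M ⊆ B(H)` is a factor of type `II₁`: it is nonzero, its centre consists
of the scalars, it is finite (every isometry in `M` is unitary, i.e. the identity is a finite
projection), and it has no minimal projection. -/
structure IsIIOneFactor (M : VonNeumannAlgebra H) : Prop where
  one_ne_zero : (1 : H →L[ℂ] H) ≠ 0
  center_trivial : ∀ x ∈ M, x ∈ M.commutant → ∃ c : ℂ, x = c • (1 : H →L[ℂ] H)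
  finite : ∀ v ∈ M, star v * v = 1 → v * star v = 1
  no_minimal_projection : ∀ p ∈ M, IsStarProjection p → p ≠ 0 →
    ∃ q ∈ M, IsStarProjection q ∧ q ≤ p ∧ q ≠ 0 ∧ q ≠ p

/-- A faithful normal unital trace (faithful normal tracial state) on `M`. The order on `M` is the
usual (Loewner) order of operators. -/
structure FaithfulNormalTrace (M : VonNeumannAlgebra H) where
  toLinearMap : M.toStarSubalgebra →ₗ[ℂ] ℂ
  map_one : toLinearMap 1 = 1
  map_mul_comm : ∀ x y, toLinearMap (x * y) = toLinearMap (y * x)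
  map_nonneg : ∀ x, 0 ≤ x → 0 ≤ toLinearMap x
  faithful : ∀ x, 0 ≤ x → toLinearMap x = 0 → x = 0
  /-- Normality: `τ` preserves suprema of increasing nets of positive elements. -/
  normal : ∀ (D : Set M.toStarSubalgebra) (x : M.toStarSubalgebra),
    D.Nonempty → DirectedOn (· ≤ ·) D → (∀ y ∈ D, 0 ≤ y) → IsLUB D x →
      IsLUB ((fun y => (toLinearMap y).re) '' D) (toLinearMap x).re

noncomputable instance (M : VonNeumannAlgebra H) :
    CoeFun (FaithfulNormalTrace M) (fun _ => M.toStarSubalgebra → ℂ) :=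
  ⟨fun τ => τ.toLinearMap⟩

namespace VonNeumannAlgebra

variable (M : VonNeumannAlgebra H)

theorem mem_of_commute_of_commute_commutant {x : H →L[ℂ] H}
    (h : ∀ y ∈ M.commutant, Commute x y) : x ∈ M := by
  rw [← commutant_commutant M, mem_commutant_iff]
  intro y hy
  exact (h y hy).symm.eq

theorem cfc_real_mem (f : ℝ → ℝ) {x : H →L[ℂ] H} (hx : x ∈ M) : cfc f x ∈ M := by
  apply mem_of_commute_of_commute_commutant
  intro y hy
  have hc : Commute x y := mem_commutant_iff.mp hy x hx
  exact hc.cfc_real f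

theorem abs_mem {x : H →L[ℂ] H} (hx : x ∈ M) : CFC.abs x ∈ M := by
  have h : star x * x ∈ M := mul_mem (star_mem hx) hx
  apply mem_of_commute_of_commute_commutant
  intro y hy
  have hc : Commute (star x * x) y := mem_commutant_iff.mp hy _ h
  rw [CFC.abs, CFC.sqrt]
  exact hc.cfcₙ_nnreal _

variable {M}

/-- The continuous functional calculus `f(T)`, as an element of the von Neumann algebra. -/
noncomputable def fcalc (f : ℝ → ℝ) (T : M.toStarSubalgebra) : M.toStarSubalgebra :=
  ⟨cfc f (T : H →L[ℂ] H), M.cfc_real_mem f T.2⟩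

/-- The absolute value `|T| = (T* T)^{1/2}`, as an element of the von Neumann algebra. -/
noncomputable def absVal (T : M.toStarSubalgebra) : M.toStarSubalgebra :=
  ⟨CFC.abs (T : H →L[ℂ] H), M.abs_mem T.2⟩

end VonNeumannAlgebra

namespace FaithfulNormalTrace

open VonNeumannAlgebra

variable {M : VonNeumannAlgebra H} (τ : FaithfulNormalTrace M)

/-- The positive linear functional `f ↦ τ(f(T))` on `C_c(ℝ)`. -/
noncomputable def spectralFunctional (T : M.toStarSubalgebra) : C_c(ℝ, ℝ) →ₚ[ℝ] ℝ :=
  PositiveLinearMap.mk₀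
    { toFun := fun f => (τ (fcalc f T)).re
      map_add' := fun f g => by
        have : fcalc (⇑(f + g)) T = fcalc f T + fcalc g T :=
          Subtype.ext (cfc_add (T : H →L[ℂ] H) f g f.continuous.continuousOn
            g.continuous.continuousOn)
        rw [this, map_add, Complex.add_re]
      map_smul' := fun c f => by
        have : fcalc (⇑(c • f)) T = (c : ℂ) • fcalc f T :=
          Subtype.ext (cfc_smul c f (T : H →L[ℂ] H) f.continuous.continuousOn)
        rw [this, map_smul]
        simp }
    (fun f hf => (Complex.nonneg_iff.mp (τ.map_nonneg _
      (show (0 : H →L[ℂ] H) ≤ cfc f (T : H →L[ℂ] H) from cfc_nonneg fun x _ => hf x))).1)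

/-- The spectral distribution `m_T` of a self-adjoint `T`: the Borel measure on `ℝ` that represents
`f ↦ τ(f(T))`. By the two facts that follow, it is the Borel probability measure on `ℝ` with
`∫ sⁿ dm_T(s) = τ(Tⁿ)` for all `n ≥ 0`. -/
noncomputable def spectralDistribution (T : M.toStarSubalgebra) : MeasureTheory.Measure ℝ :=
  RealRMK.rieszMeasure (τ.spectralFunctional T)

theorem spectralDistribution_exists_bump (R : ℝ) :
    ∃ f : C_c(ℝ, ℝ), (∀ x, 0 ≤ f x ∧ f x ≤ 1) ∧ ∀ x, |x| ≤ R → f x = 1 := by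
  let g : C(ℝ, ℝ) := ⟨fun x => max 0 (min 1 (R + 1 - |x|)), by fun_prop⟩
  have hg : HasCompactSupport g := by
    refine HasCompactSupport.intro (isCompact_Icc (a := -(R + 1)) (b := R + 1)) ?_
    intro x hx
    have h : R + 1 - |x| ≤ 0 := by
      by_contra! h
      exact hx (abs_le.mp (by linarith))
    exact max_eq_left ((min_le_right _ _).trans h)
  refine ⟨⟨g, hg⟩, fun x => ⟨le_max_left _ _, max_le zero_le_one (min_le_left _ _)⟩, ?_⟩
  intro x hx
  change max 0 (min 1 (R + 1 - |x|)) = 1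
  rw [min_eq_left (by linarith), max_eq_right zero_le_one]

theorem im_eq_zero {T : M.toStarSubalgebra} (hT : IsSelfAdjoint T) : (τ T).im = 0 := by
  have hT' : IsSelfAdjoint (T : H →L[ℂ] H) := congrArg Subtype.val hT
  have h1 : T = fcalc (fun x => max x 0) T - fcalc (fun x => max (-x) 0) T := by
    apply Subtype.ext
    change (T : H →L[ℂ] H) = cfc _ (T : H →L[ℂ] H) - cfc _ (T : H →L[ℂ] H)
    rw [← cfc_sub _ _ (T : H →L[ℂ] H)]
    conv_lhs => rw [← cfc_id' ℝ (T : H →L[ℂ] H)]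
    congr 1
    funext x
    rcases le_total x 0 with h | h <;> simp [h]
  have h2 : ∀ f : ℝ → ℝ, (∀ x, 0 ≤ f x) → (τ (fcalc f T)).im = 0 := fun f hf =>
    ((Complex.nonneg_iff.mp (τ.map_nonneg _
      (show (0 : H →L[ℂ] H) ≤ cfc f (T : H →L[ℂ] H) from cfc_nonneg fun x _ => hf x))).2).symm
  rw [h1, map_sub, Complex.sub_im, h2 _ fun x => le_max_right _ _, h2 _ fun x => le_max_right _ _,
    sub_zero]

theorem spectralFunctional_apply (T : M.toStarSubalgebra) (f : C_c(ℝ, ℝ)) :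
    τ.spectralFunctional T f = (τ (fcalc f T)).re := rfl

theorem spectralFunctional_eq_of_eqOn {T : M.toStarSubalgebra} (hT : IsSelfAdjoint T) (n : ℕ)
    (f : C_c(ℝ, ℝ)) (hf : ∀ x, |x| ≤ ‖(T : H →L[ℂ] H)‖ → f x = x ^ n) :
    τ.spectralFunctional T f = (τ (T ^ n)).re := by
  have hT' : IsSelfAdjoint (T : H →L[ℂ] H) := congrArg Subtype.val hT
  have : fcalc f T = T ^ n := by
    apply Subtype.ext
    change cfc f (T : H →L[ℂ] H) = (T : H →L[ℂ] H) ^ n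
    rw [← cfc_pow_id (R := ℝ) (T : H →L[ℂ] H) n]
    refine cfc_congr fun x hx => hf x ?_
    rcases subsingleton_or_nontrivial (H →L[ℂ] H) with h | h
    · simp [spectrum.of_subsingleton] at hx
    · exact spectrum.norm_le_norm_of_mem hx
  rw [spectralFunctional_apply, this]

theorem spectralDistribution_univ_le (T : M.toStarSubalgebra) :
    τ.spectralDistribution T Set.univ ≤ 1 := by
  have hreg : (τ.spectralDistribution T).Regular := RealRMK.regular_rieszMeasure _
  rw [isOpen_univ.measure_eq_iSup_isCompact]
  refine iSup₂_le fun K _ => iSup_le fun hK => ?_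
  obtain ⟨R, hR⟩ := hK.isBounded.exists_norm_le
  obtain ⟨f, hf, hf1⟩ := spectralDistribution_exists_bump R
  refine (RealRMK.rieszMeasure_le_of_eq_one _ (fun x => (hf x).1) hK
    fun x hx => hf1 x (hR x hx)).trans ?_
  rw [← ENNReal.ofReal_one]
  apply ENNReal.ofReal_le_ofReal
  rw [spectralFunctional_apply]
  have h : 0 ≤ 1 - fcalc f T := by
    change (0 : H →L[ℂ] H) ≤ 1 - cfc f (T : H →L[ℂ] H)
    exact sub_nonneg.mpr (cfc_le_one f _ fun x _ => (hf x).2)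
  have h2 := (Complex.nonneg_iff.mp (τ.map_nonneg _ h)).1
  rw [map_sub, τ.map_one, Complex.sub_re, Complex.one_re] at h2
  linarith

theorem exists_isCompact_spectralDistribution {T : M.toStarSubalgebra} (hT : IsSelfAdjoint T) :
    ∃ K : Set ℝ, IsCompact K ∧ 1 ≤ τ.spectralDistribution T K := by
  obtain ⟨f, hf, hf1⟩ := spectralDistribution_exists_bump ‖(T : H →L[ℂ] H)‖
  refine ⟨tsupport f, f.hasCompactSupport, ?_⟩
  have h := RealRMK.le_rieszMeasure_tsupport_subset (τ.spectralFunctional T) hf le_rfl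
  rwa [τ.spectralFunctional_eq_of_eqOn hT 0 f (by simpa using hf1), pow_zero, τ.map_one,
    Complex.one_re, ENNReal.ofReal_one] at h

theorem isProbabilityMeasure_spectralDistribution {T : M.toStarSubalgebra}
    (hT : IsSelfAdjoint T) : MeasureTheory.IsProbabilityMeasure (τ.spectralDistribution T) := by
  obtain ⟨K, _, hK⟩ := τ.exists_isCompact_spectralDistribution hT
  exact ⟨le_antisymm (τ.spectralDistribution_univ_le T)
    (hK.trans (MeasureTheory.measure_mono (Set.subset_univ K)))⟩

theorem moment_spectralDistribution {T : M.toStarSubalgebra} (hT : IsSelfAdjoint T) (n : ℕ) :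
    MeasureTheory.Integrable (fun s : ℝ => s ^ n) (τ.spectralDistribution T) ∧
      ((∫ s, s ^ n ∂(τ.spectralDistribution T) : ℝ) : ℂ) = τ (T ^ n) := by
  have hprob := τ.isProbabilityMeasure_spectralDistribution hT
  obtain ⟨K, hKc, hK⟩ := τ.exists_isCompact_spectralDistribution hT
  obtain ⟨R, hR⟩ := hKc.isBounded.exists_norm_le
  obtain ⟨f, hf, hf1⟩ := spectralDistribution_exists_bump (max R ‖(T : H →L[ℂ] H)‖)
  let g : C_c(ℝ, ℝ) := ⟨⟨fun x => x ^ n * f x, by fun_prop⟩, f.hasCompactSupport.mul_left⟩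
  have hg : ∀ x, |x| ≤ max R ‖(T : H →L[ℂ] H)‖ → g x = x ^ n := fun x hx => by
    change x ^ n * f x = x ^ n
    rw [hf1 x hx, mul_one]
  have hae : (fun x => g x) =ᵐ[τ.spectralDistribution T] fun x => x ^ n := by
    have h0 : τ.spectralDistribution T Kᶜ = 0 := by
      rw [MeasureTheory.prob_compl_eq_zero_iff hKc.measurableSet]
      exact le_antisymm MeasureTheory.prob_le_one hK
    filter_upwards [MeasureTheory.measure_eq_zero_iff_ae_notMem.mp h0] with x hx
    exact hg x ((hR x (not_not.mp hx)).trans (le_max_left _ _))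
  have hint : MeasureTheory.Integrable (fun x => g x) (τ.spectralDistribution T) :=
    g.continuous.integrable_of_hasCompactSupport g.hasCompactSupport
  refine ⟨hint.congr hae, ?_⟩
  rw [← MeasureTheory.integral_congr_ae hae, spectralDistribution, RealRMK.integral_rieszMeasure,
    τ.spectralFunctional_eq_of_eqOn hT n g fun x hx => hg x (hx.trans (le_max_right _ _))]
  exact Complex.ext rfl (τ.im_eq_zero (hT.pow n)).symm

/-- The eigenvalue function `λ_s(T) = inf {t ∈ ℝ : m_T((t, ∞)) ≤ s}` of a self-adjoint `T`,
for `s ∈ [0, 1)`. -/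
noncomputable def eigenvalueFunction (T : M.toStarSubalgebra) (s : ℝ) : ℝ :=
  sInf {t : ℝ | τ.spectralDistribution T (Set.Ioi t) ≤ ENNReal.ofReal s}

/-- The singular value function `μ_s(T) = λ_s(|T|)` of an arbitrary `T`, for `s ∈ [0, 1)`. -/
noncomputable def singularValueFunction (T : M.toStarSubalgebra) (s : ℝ) : ℝ :=
  τ.eigenvalueFunction (absVal T) s

end FaithfulNormalTrace
end IIOneFactor

/-! A bounded spectral distribution is recovered from its quantile function, so equal singular
values give `|S|` and `|T|` the same distribution, hence the same first moment. As `T = |T|`, this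
yields `τ S = τ |T| = τ |S|`, and it remains to treat equality in `|τ(S)| ≤ τ(|S|)`. That case is a
completed square, modelled on `|z - r|² / r = |z|² / r - 2 Re z + r`, which vanishes for `r = |z| =
Re z`. With `A = |S|`, `P = A + ε` and `D = S - P`, the trace of `D P⁻¹ D*` is at most `ε`. Since
`P⁻¹ ≥ 1 / (‖A‖ + ε)`, `τ(D* D)` is `O(ε)`; letting `ε → 0`, faithfulness forces `S = A ≥ 0`. No
polar decomposition is needed. -/

open MeasureTheory in
/-- The quantile function of a probability measure with bounded support determines the tails. -/
theorem MeasureTheory.measure_Ioi_le_of_sInf_eq {m n : Measure ℝ} [IsProbabilityMeasure m]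
    [IsProbabilityMeasure n] {J K : Set ℝ} (hJ : IsCompact J) (hmJ : 1 ≤ m J) (hK : IsCompact K)
    (hnK : 1 ≤ n K)
    (h : ∀ s ∈ Set.Ico (0 : ℝ) 1, sInf {t : ℝ | m (Set.Ioi t) ≤ ENNReal.ofReal s} =
      sInf {t : ℝ | n (Set.Ioi t) ≤ ENNReal.ofReal s}) (t : ℝ) :
    n (Set.Ioi t) ≤ m (Set.Ioi t) := by
  by_contra! hlt
  have hm1 : m (Set.Ioi t) < 1 := hlt.trans_le prob_le_one
  have hofReal : ENNReal.ofReal (m (Set.Ioi t)).toReal = m (Set.Ioi t) :=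
    ENNReal.ofReal_toReal (measure_ne_top _ _)
  -- Compare the quantiles at the level `s = m (t, ∞)`, which lies below 1 by the strict inequality
  -- being refuted.
  have hs := h (m (Set.Ioi t)).toReal
    ⟨ENNReal.toReal_nonneg, by simpa using (ENNReal.toReal_lt_toReal (by simp) (by simp)).mpr hm1⟩
  rw [hofReal] at hs
  obtain ⟨a, ha⟩ := hJ.bddBelow
  obtain ⟨b, hb⟩ := hK.bddAbove
  -- Compact support makes both infima genuine, rather than the default value 0 of `sInf` on `ℝ`.
  have hbdd : BddBelow {u : ℝ | m (Set.Ioi u) ≤ m (Set.Ioi t)} := by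
    refine ⟨a, fun u hu => ?_⟩
    by_contra! hua
    have hsub : J ⊆ Set.Ioi u := fun x hx => hua.trans_le (ha hx)
    exact absurd ((hmJ.trans (measure_mono hsub)).trans hu) (not_le.mpr hm1)
  have hne : {u : ℝ | n (Set.Ioi u) ≤ m (Set.Ioi t)}.Nonempty := by
    refine ⟨b, ?_⟩
    have hKc : n Kᶜ = 0 := by
      rw [prob_compl_eq_zero_iff hK.measurableSet]
      exact le_antisymm prob_le_one hnK
    have hsub : Set.Ioi b ⊆ Kᶜ := fun x hx hxK => absurd (hb hxK) (not_le.mpr hx)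
    exact (measure_mono_null hsub hKc).trans_le zero_le
  have hle : sInf {u : ℝ | n (Set.Ioi u) ≤ m (Set.Ioi t)} ≤ t := hs ▸ csInf_le hbdd (le_refl (m (Set.Ioi t)))
  have hn : ∀ u, t < u → n (Set.Ioi u) ≤ m (Set.Ioi t) := fun u hu => by
    obtain ⟨v, hv, hvu⟩ := exists_lt_of_csInf_lt hne (hle.trans_lt hu)
    exact (measure_mono (Set.Ioi_subset_Ioi hvu.le)).trans hv
  -- Tails are right-continuous, so the bound for all `u > t` passes to `t`.
  obtain ⟨u, hu_anti, hu_gt, hu_lim⟩ := exists_seq_strictAnti_tendsto t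
  have hunion : Set.Ioi t = ⋃ k, Set.Ioi (u k) := by
    ext x
    simp only [Set.mem_Ioi, Set.mem_iUnion]
    exact ⟨fun hx => (hu_lim.eventually_lt_const hx).exists, fun ⟨k, hk⟩ => (hu_gt k).trans hk⟩
  have hmono : Monotone fun k => Set.Ioi (u k) := fun i j hij =>
    Set.Ioi_subset_Ioi (hu_anti.antitone hij)
  refine absurd ?_ (not_le.mpr hlt)
  conv_lhs => rw [hunion]
  rw [hmono.measure_iUnion]
  exact iSup_le fun k => hn _ (hu_gt k)

open MeasureTheory in
theorem MeasureTheory.Measure.eq_of_sInf_eq {m n : Measure ℝ} [IsProbabilityMeasure m]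
    [IsProbabilityMeasure n] {J K : Set ℝ} (hJ : IsCompact J) (hmJ : 1 ≤ m J) (hK : IsCompact K)
    (hnK : 1 ≤ n K)
    (h : ∀ s ∈ Set.Ico (0 : ℝ) 1, sInf {t : ℝ | m (Set.Ioi t) ≤ ENNReal.ofReal s} =
      sInf {t : ℝ | n (Set.Ioi t) ≤ ENNReal.ofReal s}) : m = n := by
  refine Measure.ext_of_Iic m n fun t => ?_
  have ht : m (Set.Ioi t) = n (Set.Ioi t) := le_antisymm
    (measure_Ioi_le_of_sInf_eq hK hnK hJ hmJ (fun s hs => (h s hs).symm) t)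
    (measure_Ioi_le_of_sInf_eq hJ hmJ hK hnK h t)
  rw [← Set.compl_Ioi, prob_compl_eq_one_sub measurableSet_Ioi,
    prob_compl_eq_one_sub measurableSet_Ioi, ht]

namespace FaithfulNormalTrace

open VonNeumannAlgebra

variable {H : Type*} [NormedAddCommGroup H] [InnerProductSpace ℂ H] [CompleteSpace H]
  {M : VonNeumannAlgebra H} (τ : FaithfulNormalTrace M)

theorem absVal_nonneg (T : M.toStarSubalgebra) : 0 ≤ absVal T :=
  CFC.abs_nonneg (T : H →L[ℂ] H)

theorem absVal_of_nonneg {T : M.toStarSubalgebra} (hT : 0 ≤ T) : absVal T = T :=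
  Subtype.ext (CFC.abs_of_nonneg (T : H →L[ℂ] H) hT)

theorem absVal_mul_absVal (T : M.toStarSubalgebra) : absVal T * absVal T = star T * T :=
  Subtype.ext (CFC.abs_mul_abs (T : H →L[ℂ] H))

theorem isSelfAdjoint_of_nonneg {T : M.toStarSubalgebra} (hT : 0 ≤ T) : IsSelfAdjoint T :=
  Subtype.ext (IsSelfAdjoint.of_nonneg (show 0 ≤ (T : H →L[ℂ] H) from hT))

theorem re_mono {x y : M.toStarSubalgebra} (h : x ≤ y) : (τ x).re ≤ (τ y).re := by
  have h0 : 0 ≤ y - x := sub_nonneg.mpr (show (x : H →L[ℂ] H) ≤ y from h)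
  have := (Complex.nonneg_iff.mp (τ.map_nonneg _ h0)).1
  rw [map_sub, Complex.sub_re] at this
  linarith

theorem eq_zero_of_re_star_mul_self_nonpos {x : M.toStarSubalgebra}
    (h : (τ (star x * x)).re ≤ 0) : x = 0 := by
  have h0 : 0 ≤ star x * x := star_mul_self_nonneg (x : H →L[ℂ] H)
  have h1 := Complex.nonneg_iff.mp (τ.map_nonneg _ h0)
  have h2 : star x * x = 0 := τ.faithful _ h0 (Complex.ext (le_antisymm h h1.1) h1.2.symm)
  have h3 : star (x : H →L[ℂ] H) * x = 0 := congrArg Subtype.val h2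
  exact Subtype.ext ((CStarRing.star_mul_self_eq_zero_iff _).mp h3)

/-- The element `i (x - x*)` is self-adjoint, so its trace is real. -/
theorem re_star (x : M.toStarSubalgebra) : (τ (star x)).re = (τ x).re := by
  have h1 : IsSelfAdjoint (Complex.I • (x - star x)) := by
    rw [IsSelfAdjoint, star_smul, star_sub, star_star]
    simp only [RCLike.star_def, Complex.conj_I, neg_smul, ← smul_neg, neg_sub]
  have h2 := τ.im_eq_zero h1
  rw [map_smul, map_sub] at h2
  simp at h2
  linarith

/-- Traces of absolute values are determined by singular value functions. -/
theorem apply_absVal_eq_of_singularValueFunction_eq {S T : M.toStarSubalgebra}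
    (h : ∀ s ∈ Set.Ico (0 : ℝ) 1, τ.singularValueFunction S s = τ.singularValueFunction T s) :
    τ (absVal S) = τ (absVal T) := by
  have hS := isSelfAdjoint_of_nonneg (absVal_nonneg S)
  have hT := isSelfAdjoint_of_nonneg (absVal_nonneg T)
  have := τ.isProbabilityMeasure_spectralDistribution hS
  have := τ.isProbabilityMeasure_spectralDistribution hT
  obtain ⟨J, hJ, hJ1⟩ := τ.exists_isCompact_spectralDistribution hS
  obtain ⟨K, hK, hK1⟩ := τ.exists_isCompact_spectralDistribution hT
  have heq := MeasureTheory.Measure.eq_of_sInf_eq hJ hJ1 hK hK1 h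
  have hmS := (τ.moment_spectralDistribution hS 1).2
  have hmT := (τ.moment_spectralDistribution hT 1).2
  rw [pow_one] at hmS hmT
  rw [← hmS, ← hmT, heq]

/-- The resolvent of a positive element at `-ε`. -/
theorem exists_resolvent {A : M.toStarSubalgebra} (hA : 0 ≤ A) {ε : ℝ} (hε : 0 < ε) :
    ∃ B : M.toStarSubalgebra, B * (A + (ε : ℂ) • 1) = 1 ∧ (A + (ε : ℂ) • 1) * B = 1 ∧
      0 ≤ B * A ∧ 1 ≤ ((‖(A : H →L[ℂ] H)‖ + ε : ℝ) : ℂ) • B := by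
  have hA' : 0 ≤ (A : H →L[ℂ] H) := hA
  have hsa : IsSelfAdjoint (A : H →L[ℂ] H) := .of_nonneg hA'
  have hspec : ∀ x ∈ spectrum ℝ (A : H →L[ℂ] H), 0 ≤ x := fun x hx =>
    spectrum_nonneg_of_nonneg hA' hx
  have hcont : ContinuousOn (fun x : ℝ => (x + ε)⁻¹) (spectrum ℝ (A : H →L[ℂ] H)) :=
    ContinuousOn.inv₀ (by fun_prop) fun x hx => by linarith [hspec x hx]
  have hP : (A : H →L[ℂ] H) + (ε : ℂ) • 1 = cfc (fun x : ℝ => x + ε) (A : H →L[ℂ] H) := by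
    rw [cfc_add_const ε (fun x => x) (A : H →L[ℂ] H), cfc_id' ℝ (A : H →L[ℂ] H),
      Algebra.algebraMap_eq_smul_one]
    rfl
  refine ⟨fcalc (fun x => (x + ε)⁻¹) A, Subtype.ext ?_, Subtype.ext ?_, ?_, ?_⟩
  · change cfc _ (A : H →L[ℂ] H) * ((A : H →L[ℂ] H) + (ε : ℂ) • 1) = 1
    rw [hP, ← cfc_mul _ _ _ hcont, ← cfc_one ℝ (A : H →L[ℂ] H)]
    refine cfc_congr fun x hx => ?_
    have := hspec x hx
    exact inv_mul_cancel₀ (by positivity)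
  · change ((A : H →L[ℂ] H) + (ε : ℂ) • 1) * cfc _ (A : H →L[ℂ] H) = 1
    rw [hP, ← cfc_mul _ _ _ (by fun_prop) hcont, ← cfc_one ℝ (A : H →L[ℂ] H)]
    refine cfc_congr fun x hx => ?_
    have := hspec x hx
    exact mul_inv_cancel₀ (by positivity)
  · change 0 ≤ cfc (fun x : ℝ => (x + ε)⁻¹) (A : H →L[ℂ] H) * (A : H →L[ℂ] H)
    nth_rw 2 [← cfc_id' ℝ (A : H →L[ℂ] H)]
    rw [← cfc_mul _ _ _ hcont]
    refine cfc_nonneg fun x hx => ?_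
    have := hspec x hx
    positivity
  · change 1 ≤ (‖(A : H →L[ℂ] H)‖ + ε) • cfc (fun x : ℝ => (x + ε)⁻¹) (A : H →L[ℂ] H)
    rw [← cfc_smul _ _ _ hcont, ← cfc_one ℝ (A : H →L[ℂ] H)]
    refine cfc_mono (fun x hx => ?_) (by fun_prop) (by fun_prop)
    have h0 := hspec x hx
    have h1 : x ≤ ‖(A : H →L[ℂ] H)‖ := by
      rcases subsingleton_or_nontrivial (H →L[ℂ] H) with h | h
      · simp [spectrum.of_subsingleton] at hx
      · exact (le_abs_self x).trans (spectrum.norm_le_norm_of_mem hx)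
    change 1 ≤ (‖(A : H →L[ℂ] H)‖ + ε) * (x + ε)⁻¹
    rw [← div_eq_mul_inv, one_le_div (by positivity)]
    linarith

/-- The quantitative form of the equality case: the shift by `ε` makes `|S|` invertible, and its
cost vanishes with `ε`. -/
theorem re_star_sub_absVal_mul_le {S : M.toStarSubalgebra} (h : τ S = τ (absVal S)) {ε : ℝ}
    (hε : 0 < ε) :
    (τ (star (S - absVal S) * (S - absVal S))).re ≤
      (‖(absVal S : H →L[ℂ] H)‖ + ε) * ε := by
  set A := absVal S with hAdef
  have hA : 0 ≤ A := absVal_nonneg S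
  have hAA : A * A = star S * S := absVal_mul_absVal S
  have hAs : star A = A := isSelfAdjoint_of_nonneg hA
  obtain ⟨B, hBP, hPB, hBA, hB1⟩ := exists_resolvent hA hε
  set c : ℝ := ‖(A : H →L[ℂ] H)‖ + ε with hc
  have hc0 : 0 ≤ c := by positivity
  set P := A + (ε : ℂ) • (1 : M.toStarSubalgebra) with hPdef
  have hPs : star P = P := by
    rw [hPdef, star_add, hAs, star_smul, star_one]
    simp
  have hD : ∃ D, D = S - P := ⟨_, rfl⟩
  obtain ⟨D, hD⟩ := hD
  -- `τ(D B D*) ≤ ε`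
  have hDBD : D * B * star D = S * B * star S - S - star S + P := by
    rw [hD, star_sub, hPs, sub_mul, hPB, mul_sub, sub_mul, sub_mul, mul_assoc S B P, hBP]
    noncomm_ring
  -- Since `B * A ≥ 0`, this gives `τ(B A²) ≤ τ(A)`; by traciality and `A² = S* S`, the left side is
  -- `τ(S B S*)`.
  have hAB : A - B * (A * A) = (ε : ℂ) • (B * A) := by
    have : A = B * P * A := by rw [hBP, one_mul]
    nth_rw 1 [this]
    rw [hPdef]
    simp [mul_add, add_mul, mul_assoc]
  have hτ1 : (τ (S * B * star S)).re ≤ (τ A).re := by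
    rw [τ.map_mul_comm (S * B) (star S), ← mul_assoc, τ.map_mul_comm, ← hAA]
    have h1 := (Complex.nonneg_iff.mp (τ.map_nonneg _ hBA)).1
    have h2 := congrArg (fun x => (τ x).re) hAB
    simp only [map_sub, map_smul, Complex.sub_re, smul_eq_mul, Complex.re_ofReal_mul] at h2
    nlinarith [mul_nonneg hε.le h1]
  have hτP : (τ P).re = (τ A).re + ε := by
    rw [hPdef, map_add, map_smul, τ.map_one]
    simp
  -- The real parts add up to at most `τ A - 2 τ A + (τ A + ε)`.
  have hτ2 : (τ (D * B * star D)).re ≤ ε := by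
    rw [hDBD, map_add, map_sub, map_sub, Complex.add_re, Complex.sub_re, Complex.sub_re,
      τ.re_star, hτP, h]
    linarith
  -- Conjugate `1 ≤ c B` by `D` to remove the weight `B`.
  have hle : D * star D ≤ (c : ℂ) • (D * B * star D) := by
    have h1 : (1 : H →L[ℂ] H) ≤ (c : ℂ) • (B : H →L[ℂ] H) := hB1
    have h2 := star_right_conjugate_le_conjugate h1 (D : H →L[ℂ] H)
    rw [mul_one, mul_smul_comm, smul_mul_assoc] at h2
    exact h2
  have hτ3 : (τ (star D * D)).re ≤ c * ε := by
    rw [τ.map_mul_comm]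
    refine (τ.re_mono hle).trans ?_
    rw [map_smul, smul_eq_mul, Complex.re_ofReal_mul]
    exact mul_le_mul_of_nonneg_left hτ2 hc0
  -- Under `τ` the cross terms vanish because `τ (S - A) = 0`, and the remaining `ε²` only helps the
  -- bound.
  have hexp : star D * D = star (S - A) * (S - A) - (ε : ℂ) • star (S - A) - (ε : ℂ) • (S - A)
      + ((ε * ε : ℝ) : ℂ) • 1 := by
    have hD' : D = (S - A) - (ε : ℂ) • 1 := by rw [hD, hPdef]; abel
    have hε' : star (ε : ℂ) = ε := Complex.conj_ofReal ε
    rw [hD']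
    generalize S - A = E
    rw [star_sub, star_smul, star_one, hε', sub_mul, mul_sub, mul_sub, mul_smul_comm,
      mul_one, smul_mul_assoc, one_mul, smul_mul_smul_comm, one_mul, Complex.ofReal_mul]
    abel
  have h0 : τ (S - A) = 0 := by rw [map_sub, h, sub_self]
  have h0' : (τ (star (S - A))).re = 0 := by rw [τ.re_star, h0, Complex.zero_re]
  have h4 := congrArg (fun x => (τ x).re) hexp
  simp only [map_add, map_sub, map_smul, Complex.add_re, Complex.sub_re, smul_eq_mul,
    Complex.re_ofReal_mul, τ.map_one, Complex.one_re] at h4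
  rw [map_sub] at h0
  have h0r := congrArg Complex.re h0
  rw [star_sub, map_sub] at h0'
  simp only [Complex.sub_re, Complex.zero_re] at h0r h0'
  simp only [star_sub, map_sub, Complex.sub_re] at h4 ⊢
  nlinarith [mul_self_nonneg ε]

/-- Equality case of `|τ(S)| ≤ τ(|S|)`. -/
theorem eq_absVal_of_apply_eq {S : M.toStarSubalgebra} (h : τ S = τ (absVal S)) :
    S = absVal S := by
  refine sub_eq_zero.mp (τ.eq_zero_of_re_star_mul_self_nonpos ?_)
  have hlim : Filter.Tendsto (fun ε : ℝ => (‖(absVal S : H →L[ℂ] H)‖ + ε) * ε)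
      (nhdsWithin 0 (Set.Ioi 0)) (nhds 0) := by
    have : Continuous fun ε : ℝ => (‖(absVal S : H →L[ℂ] H)‖ + ε) * ε := by fun_prop
    simpa using (this.tendsto 0).mono_left nhdsWithin_le_nhds
  exact ge_of_tendsto hlim (Filter.eventually_of_mem self_mem_nhdsWithin fun ε hε =>
    τ.re_star_sub_absVal_mul_le h hε)

end FaithfulNormalTrace

theorem mainTheorem8 {H : Type*} [NormedAddCommGroup H] [InnerProductSpace ℂ H] [CompleteSpace H]
    (M : VonNeumannAlgebra H) (hM : IsIIOneFactor M) (τ : FaithfulNormalTrace M)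
    (S T : M.toStarSubalgebra) (hT : 0 ≤ T)
    (hμ : ∀ s ∈ Set.Ico (0 : ℝ) 1,
      τ.singularValueFunction S s = τ.singularValueFunction T s)
    (hτ : τ S = τ T) :
    0 ≤ S := by
  have h : τ S = τ (VonNeumannAlgebra.absVal S) := by
    rw [τ.apply_absVal_eq_of_singularValueFunction_eq hμ,
      FaithfulNormalTrace.absVal_of_nonneg hT, hτ]
  rw [τ.eq_absVal_of_apply_eq h]
  exact FaithfulNormalTrace.absVal_nonneg S
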